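/- Let $\mathcal R$ be a finite commutative chain ring with maximal ideal $\langle\gamma\rangle$, let $e$ be the nilpotency index of $\gamma$, and let $p$ be the characteristic of the residue field $\overline{\mathcal R}=\mathcal R/\langle\gamma\rangle$. Let $n\ge 1$ and $s\ge 0$ be integers with $\gcd(n,p)=1$, let $\beta$ be a unit of $\mathcal R$, and put $\lambda=1+\gamma\beta$, $N=np^s$ and $\mathcal R_\lambda=\mathcal R[x]/\langle x^{N}-\lambda\rangle$. Let $x^n-1=f_1(x)f_2(x)\cdots f_r(x)$, where $f_1(x)=x-1$ and the $f_\ell(x)\in\mathcal R[x]$ are monic, pairwise coprime and basic irreducible (i.e. irreducible modulo $\gamma$), and let $d_\ell=\deg f_\ell(x)$. For $a=(a_0,\dots,a_{N-1})\in\mathcal R^{N}$ let $D(a)=(a_1-a_0,\dots,a_{N-1}-a_{N-2})\in\mathcal R^{N-1}$, and let $D^i(a)\in\mathcal R^{N-i}$ be the $i$-th iterate. The depth of $a$ is the smallest $i$ with $0\le i\le N-1$ and $D^i(a)=0$ if such an $i$ exists, and it is $N$ otherwise. A $\lambda$-constacyclic code of length $N$ over $\mathcal R$ is an ideal of $\mathcal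 R_\lambda$, regarded as a subset of $\mathcal R^{N}$ through $(a_0,\dots,a_{N-1})\mapsto a_0+a_1x+\cdots+a_{N-1}x^{N-1}$. The depth spectrum $\mathrm{Depth}(\mathcal C)$ of a code $\mathcal C$ of length $N$ is the set of all $i\in\{1,\dots,N\}$ that are the depth of some codeword of $\mathcal C$. **Theorem.** Let $0\le k_\ell\le ep^s$ for $1\le\ell\le r$, and let $\mathcal C=\big\langle (x-1)^{k_1}\prod_{\ell=2}^{r}f_\ell(x)^{k_\ell}\big\rangle$ be the corresponding $\lambda$-constacyclic code of length $np^s$ over $\mathcal R$. Put $$\tau_\ell(i)=\min\{(i+1)p^s,k_\ell\}-\min\{ip^s,k_\ell\}\quad(0\le i\le e-1),\qquad \mathcal S_2(\mathcal C)=\sum_{\ell=2}^{r}d_\ell\,\tau_\ell(e-1).$$ Then $$\mathrm{Depth}(\mathcal C)=\begin{cases}\{1,2,\dots,np^s\} & \text{if } 0\le k_1<\max\{0,(e-n)p^s\},\\[2pt] \{1,2,\dots,ep^s-k_1\}\cup\{p^s+\mathcal S_2(\mathcal C)+1,\dots,np^s\} & \text{otherwise,}\end{cases}$$ where $\{a,a+1,\dots,b\}$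 denotes the empty set if $b<a$. -/

import Mathlib

open Polynomial IsLocalRing

/-- A (commutative) chain ring: a local ring whose ideals are totally ordered by inclusion. -/
class IsChainRing (R : Type*) [CommRing R] : Prop extends IsLocalRing R where
  ideal_total : ∀ I J : Ideal R, I ≤ J ∨ J ≤ I

/-- The derivative `D : R^N → R^(N-1)`,
`D(a_0, …, a_{N-1}) = (a_1 - a_0, …, a_{N-1} - a_{N-2})`. -/
def vecDeriv {R : Type*} [CommRing R] {N : ℕ} (a : Fin N → R) : Fin (N - 1) → R :=
  fun j => a ⟨j.1 + 1, by omega⟩ - a ⟨j.1, by omega⟩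

/-- The iterated derivative `D^i : R^N → R^(N-i)`. -/
def iterVecDeriv {R : Type*} [CommRing R] {N : ℕ} (a : Fin N → R) :
    (i : ℕ) → Fin (N - i) → R
  | 0 => a
  | i + 1 => vecDeriv (iterVecDeriv a i)

open Classical in
/-- The depth of `a ∈ R^N`: the smallest `i` with `0 ≤ i ≤ N - 1` and `D^i(a) = 0` if there is
one, and `N` otherwise. -/
noncomputable def depth {R : Type*} [CommRing R] {N : ℕ} (a : Fin N → R) : ℕ :=
  if h : ∃ i, i < N ∧ iterVecDeriv a i = 0 then Nat.find h else N

/-- The depth spectrum of a code of length `N`: all `i` with `1 ≤ i ≤ N` such that at least one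
codeword has depth `i`. -/
def depthSpectrum {R : Type*} [CommRing R] {N : ℕ} (𝒞 : Set (Fin N → R)) : Set ℕ :=
  {i | 1 ≤ i ∧ i ≤ N ∧ ∃ c ∈ 𝒞, depth c = i}

/-- The ring `R[x] / ⟨x^N - lam⟩`. -/
abbrev ConstacyclicRing {R : Type*} [CommRing R] (N : ℕ) (lam : R) : Type _ :=
  R[X] ⧸ Ideal.span {(X ^ N - C lam : R[X])}

/-- The standard `R`-linear map `R^N → R[x] / ⟨x^N - lam⟩`,
`(a_0, …, a_{N-1}) ↦ a_0 + a_1 x + ⋯ + a_{N-1} x^(N-1) + ⟨x^N - lam⟩`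
(an isomorphism for `N ≥ 1`). -/
noncomputable def vecToRing {R : Type*} [CommRing R] (N : ℕ) (lam : R) (a : Fin N → R) :
    ConstacyclicRing N lam :=
  Ideal.Quotient.mk _ (∑ i : Fin N, C (a i) * X ^ (i : ℕ))

/-- The `lam`-constacyclic code of length `N` given by an ideal of `R[x] / ⟨x^N - lam⟩`, as a set
of vectors in `R^N`. -/
def codeOfIdeal {R : Type*} [CommRing R] {N : ℕ} {lam : R} (I : Ideal (ConstacyclicRing N lam)) :
    Set (Fin N → R) :=
  {a | vecToRing N lam a ∈ I}

/-- A polynomial over a local ring is basic irreducible if its reduction modulo the maximal ideal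
is irreducible over the residue field. -/
def IsBasicIrreducible {R : Type*} [CommRing R] [IsLocalRing R] (f : R[X]) : Prop :=
  Irreducible (f.map (residue R))

/-- `g = ∏ f_ℓ` with monic basic irreducible pairwise coprime polynomials `f_ℓ`. -/
structure IsBasicFactorization {R : Type*} [CommRing R] [IsLocalRing R] {r : ℕ}
    (g : R[X]) (f : Fin r → R[X]) : Prop where
  monic : ∀ l, (f l).Monic
  basicIrreducible : ∀ l, IsBasicIrreducible (f l)
  coprime : ∀ l l', l ≠ l' → IsCoprime (f l) (f l')
  prod_eq : ∏ l, f l = g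

/-- `τ(i) = min{(i+1)q, k} - min{iq, k}`, where `q` stands for `p^s`. -/
def tau (q k i : ℕ) : ℕ := min ((i + 1) * q) k - min (i * q) k

/-! Work in `A = R[x]/⟨x^N - λ⟩` with `q = p^s`, `y = x⁻¹`, and `F_ℓ` the image of `f_ℓ`.
Multiplication by `y` shifts coordinates, so the entries of `D^i(c)` are the first `N - i`
coordinates of `(y - 1)^i c`, and `y - 1` is `-y(x - 1)`. Moreover `γ` is a unit times `(x^n -
1)^q`, so `(∏ F_ℓ)^(eq) = 0`, and identities in `A` can be checked one coprime factor at a time. Put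
`t_ℓ = max(k_ℓ - (e-1)q, 0) = τ_ℓ(e-1)` and `m = q + S₂`.

Small depths: `F_0^(eq-i) ∏_{ℓ≥2} F_ℓ^(eq)` is killed by `(x - 1)^i` and by no smaller power, and it
lies in the code for `i ≤ eq - k_1`.

Large depths: with `G = (x-1)^q ∏_{ℓ≥2} f_ℓ^(t_ℓ)`, monic of degree `m`, the code contains words
whose `m`-th difference is any prescribed sequence times `γ^(e-1)` (`exists_pow_mul_eq`,
`exists_mk_monic_mul_constTerm_eq`). Taking the sequence `j ↦ C(j, d)` gives depth `m + d + 1`.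

No others: suppose `eq - k_1 < depth c ≤ m`. Then `w = (y - 1)^m c` starts with `N - m` zeros. If
`γw = 0`, the monic `H = ∏_{ℓ≥2} f_ℓ^(q-t_ℓ)`, of degree `N - m`, kills `w`, and a degree count
gives `w = 0`; induction on powers of `γ` removes the assumption. So a power of `x - 1` kills `c`,
hence `(x - 1)^(eq-k_1)` does, a contradiction. -/

theorem iterVecDeriv_eq_zero_of_le {R : Type*} [CommRing R] {N : ℕ} {c : Fin N → R} {i j : ℕ}
    (hij : i ≤ j) (h : iterVecDeriv c i = 0) : iterVecDeriv c j = 0 := by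
  induction j, hij using Nat.le_induction with
  | base => exact h
  | succ j _ ih =>
    funext l
    change vecDeriv (iterVecDeriv c j) l = 0
    rw [ih]
    simp [vecDeriv]

theorem depth_eq_of_iterVecDeriv {R : Type*} [CommRing R] {N : ℕ} {c : Fin N → R} {i : ℕ}
    (hi : i + 1 ≤ N) (h₁ : iterVecDeriv c i ≠ 0) (h₂ : i + 1 < N → iterVecDeriv c (i + 1) = 0) :
    depth c = i + 1 := by
  classical
  unfold depth
  split_ifs with h
  · rw [Nat.find_eq_iff]
    obtain ⟨j, hj, hj0⟩ := h
    have hij : i < j := by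
      by_contra hji
      exact h₁ (iterVecDeriv_eq_zero_of_le (not_lt.mp hji) hj0)
    exact ⟨⟨by omega, h₂ (by omega)⟩,
      fun a ha h' => h₁ (iterVecDeriv_eq_zero_of_le (by omega) h'.2)⟩
  · by_contra hne
    exact h ⟨i + 1, by omega, h₂ (by omega)⟩

theorem iterVecDeriv_eq_zero_of_depth_le {R : Type*} [CommRing R] {N : ℕ} {c : Fin N → R} {i : ℕ}
    (h : depth c ≤ i) : iterVecDeriv c i = 0 := by
  classical
  unfold depth at h
  split_ifs at h with h'
  · exact iterVecDeriv_eq_zero_of_le h (Nat.find_spec h').2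
  -- Here the depth is the default value `N ≤ i`, so `Fin (N - i)` is empty.
  · funext l
    exact absurd l.2 (by omega)

theorem depth_le_of_iterVecDeriv {R : Type*} [CommRing R] {N : ℕ} {c : Fin N → R} {i : ℕ}
    (hi : i < N) (h : iterVecDeriv c i = 0) : depth c ≤ i := by
  classical
  unfold depth
  rw [dif_pos ⟨i, hi, h⟩]
  exact Nat.find_le ⟨hi, h⟩

/-! ### Coordinates in the constacyclic ring and the shift by `y = x⁻¹`. -/

section Coordinates

variable {R : Type*} [CommRing R] {N : ℕ} {lam : R}

/-- The constant coefficient of the representative of degree less than `N`. -/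
noncomputable def constTerm (hN : N ≠ 0) : ConstacyclicRing N lam →ₗ[R] R :=
  (lcoeff R 0).comp (AdjoinRoot.modByMonicHom (monic_X_pow_sub_C lam hN))

theorem constTerm_mk (hN : N ≠ 0) (g : R[X]) :
    constTerm hN (Ideal.Quotient.mk (Ideal.span {(X ^ N - C lam : R[X])}) g) =
      (g %ₘ (X ^ N - C lam)).coeff 0 := rfl

theorem constTerm_mk_of_degree_lt (hN : N ≠ 0) {g : R[X]} (hg : g.degree < N) :
    constTerm hN (Ideal.Quotient.mk (Ideal.span {(X ^ N - C lam : R[X])}) g) = g.coeff 0 := by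
  nontriviality R
  rw [constTerm_mk, (modByMonic_eq_self_iff (monic_X_pow_sub_C lam hN)).2]
  rwa [degree_X_pow_sub_C (Nat.pos_of_ne_zero hN)]

theorem mk_eq_zero_of_degree_lt (hN : N ≠ 0) {g : R[X]} (hg : g.degree < N)
    (h : Ideal.Quotient.mk (Ideal.span {(X ^ N - C lam : R[X])}) g = 0) : g = 0 := by
  nontriviality R
  rw [Ideal.Quotient.eq_zero_iff_dvd] at h
  by_contra h0
  refine (monic_X_pow_sub_C lam hN).not_dvd_of_degree_lt h0 ?_ h
  rwa [degree_X_pow_sub_C (Nat.pos_of_ne_zero hN)]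

theorem mk_X_pow_card :
    (Ideal.Quotient.mk (Ideal.span {(X ^ N - C lam : R[X])}) X) ^ N =
      Ideal.Quotient.mk _ (C lam) := by
  rw [← map_pow, Ideal.Quotient.mk_eq_mk_iff_sub_mem]
  exact Ideal.mem_span_singleton_self _

theorem mk_C_mul_eq_smul (a : R) (z : ConstacyclicRing N lam) :
    Ideal.Quotient.mk _ (C a) * z = a • z := by
  exact (Algebra.smul_def a z).symm

theorem natDegree_lt_of_degree_lt_coe (hN : N ≠ 0) {g : R[X]} (hg : g.degree < N) :
    g.natDegree < N := by
  rcases eq_or_ne g 0 with rfl | h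
  · simpa using Nat.pos_of_ne_zero hN
  · exact (natDegree_lt_iff_degree_lt h).2 hg

variable {y : ConstacyclicRing N lam}

theorem inv_pow_card (hy : y * Ideal.Quotient.mk _ X = 1) {l : R} (hl : l * lam = 1) :
    y ^ N = Ideal.Quotient.mk _ (C l) := by
  have h := congrArg (· ^ N) hy
  simp only [mul_pow, one_pow, mk_X_pow_card] at h
  have h' : Ideal.Quotient.mk (Ideal.span {(X ^ N - C lam : R[X])}) (C l) *
      Ideal.Quotient.mk _ (C lam) = 1 := by
    rw [← map_mul, ← C_mul, hl, C_1, map_one]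
  calc y ^ N = y ^ N * (Ideal.Quotient.mk _ (C l) * Ideal.Quotient.mk _ (C lam)) := by
        rw [h', mul_one]
    _ = Ideal.Quotient.mk _ (C l) * (y ^ N * Ideal.Quotient.mk _ (C lam)) := by ring
    _ = _ := by rw [h, mul_one]

theorem constTerm_mul_X_pow (hN : N ≠ 0) (hy : y * Ideal.Quotient.mk _ X = 1)
    (hlam : IsUnit lam) {j k : ℕ} (hj : j < N) (hk : k < N) :
    constTerm hN (y ^ j * Ideal.Quotient.mk _ X ^ k) = if j = k then 1 else 0 := by
  nontriviality R
  have hdeg : ∀ i, i < N → (X ^ i : R[X]).degree < N := fun i hi => by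
    rw [degree_X_pow]; exact_mod_cast hi
  rcases le_or_gt j k with hjk | hjk
  · have : y ^ j * Ideal.Quotient.mk _ X ^ k = Ideal.Quotient.mk _ (X ^ (k - j)) := by
      obtain ⟨d, rfl⟩ := Nat.exists_eq_add_of_le hjk
      rw [pow_add, ← mul_assoc, ← mul_pow, hy, one_pow, one_mul, map_pow, Nat.add_sub_cancel_left]
    rw [this, constTerm_mk_of_degree_lt hN (hdeg _ (by omega)), coeff_X_pow]
    simp only [show (0 = k - j) ↔ j = k by omega]
  -- Wrap-around: `y^d = y^N x^(N-d) = λ⁻¹ x^(N-d)`, and `0 < N - d` leaves no constant term.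
  · obtain ⟨l, hl⟩ := hlam.exists_left_inv
    obtain ⟨d, rfl⟩ := Nat.exists_eq_add_of_le hjk.le
    obtain ⟨b, rfl⟩ := Nat.exists_eq_add_of_le (show d ≤ N by omega)
    have : y ^ (k + d) * Ideal.Quotient.mk _ X ^ k =
        Ideal.Quotient.mk _ (C l) * Ideal.Quotient.mk _ (X ^ b) := by
      rw [← inv_pow_card hy hl, map_pow]
      calc _ = (y * Ideal.Quotient.mk _ X) ^ k * y ^ d := by ring
        _ = y ^ d * (y * Ideal.Quotient.mk _ X) ^ b := by rw [hy]; ring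
        _ = _ := by ring
    rw [this, mk_C_mul_eq_smul, map_smul, constTerm_mk_of_degree_lt hN (hdeg _ (by omega)),
      coeff_X_pow, if_neg (by omega), if_neg (by omega), smul_zero]

theorem constTerm_mul_mk (hN : N ≠ 0) (hy : y * Ideal.Quotient.mk _ X = 1)
    (hlam : IsUnit lam) {g : R[X]} (hg : g.degree < N) {j : ℕ} (hj : j < N) :
    constTerm hN (y ^ j * Ideal.Quotient.mk _ g) = g.coeff j := by
  have hgs := as_sum_range' g N (natDegree_lt_of_degree_lt_coe hN hg)
  conv_lhs => rw [hgs]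
  have hterm : ∀ k ∈ Finset.range N, constTerm hN (y ^ j *
      Ideal.Quotient.mk _ (monomial k (g.coeff k))) = if j = k then g.coeff k else 0 := by
    intro k hk
    rw [← C_mul_X_pow_eq_monomial, map_mul (Ideal.Quotient.mk _), mul_left_comm, mk_C_mul_eq_smul, map_smul, map_pow,
      constTerm_mul_X_pow hN hy hlam hj (Finset.mem_range.1 hk)]
    simp
  rw [map_sum, Finset.mul_sum, map_sum, Finset.sum_congr rfl hterm]
  simp [hj]

theorem degree_sum_coord_lt (c : Fin N → R) :
    (∑ i : Fin N, C (c i) * X ^ (i : ℕ)).degree < (N : WithBot ℕ) := by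
  refine (degree_sum_le _ _).trans_lt ?_
  refine (Finset.sup_lt_iff (WithBot.bot_lt_coe N)).2 fun i _ => ?_
  exact (degree_C_mul_X_pow_le _ _).trans_lt (WithBot.coe_lt_coe.2 i.2)

theorem constTerm_mul_vecToRing (hN : N ≠ 0) (hy : y * Ideal.Quotient.mk _ X = 1)
    (hlam : IsUnit lam) (c : Fin N → R) (j : Fin N) :
    constTerm hN (y ^ (j : ℕ) * vecToRing N lam c) = c j := by
  rw [vecToRing, constTerm_mul_mk hN hy hlam (degree_sum_coord_lt c) j.2]
  simp [coeff_X_pow, Fin.val_inj]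

/-- Passing from entry `j` to entry `j + 1` is multiplication by `y`, so each `D` becomes
multiplication by `y - 1`. For `j < N - i` no wrap-around occurs. -/
theorem iterVecDeriv_apply (hN : N ≠ 0) (hy : y * Ideal.Quotient.mk _ X = 1)
    (hlam : IsUnit lam) (c : Fin N → R) (i : ℕ) (j : Fin (N - i)) :
    iterVecDeriv c i j = constTerm hN (y ^ (j : ℕ) * ((y - 1) ^ i * vecToRing N lam c)) := by
  induction i with
  | zero => rw [pow_zero, one_mul]; exact (constTerm_mul_vecToRing hN hy hlam c j).symm
  | succ i ih =>
    change iterVecDeriv c i _ - iterVecDeriv c i _ = _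
    rw [ih, ih, ← map_sub]
    congr 1
    ring

theorem exists_mk_eq (hN : N ≠ 0) (z : ConstacyclicRing N lam) :
    ∃ g : R[X], g.degree < N ∧ Ideal.Quotient.mk _ g = z := by
  nontriviality R
  obtain ⟨g, rfl⟩ := Ideal.Quotient.mk_surjective z
  have hm := monic_X_pow_sub_C lam hN
  refine ⟨g %ₘ (X ^ N - C lam), ?_, ?_⟩
  · simpa only [degree_X_pow_sub_C (Nat.pos_of_ne_zero hN)] using degree_modByMonic_lt g hm
  · rw [Ideal.Quotient.mk_eq_mk_iff_sub_mem, Ideal.mem_span_singleton]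
    refine ⟨-(g /ₘ (X ^ N - C lam)), ?_⟩
    rw [eq_sub_of_add_eq (modByMonic_add_div g (X ^ N - C lam))]
    ring

theorem vecToRing_surjective (hN : N ≠ 0) : Function.Surjective (vecToRing N lam) := by
  intro z
  obtain ⟨g, hg, rfl⟩ := exists_mk_eq hN z
  refine ⟨fun i => g.coeff i, ?_⟩
  rw [vecToRing, Fin.sum_univ_eq_sum_range (fun i => C (g.coeff i) * X ^ i) N]
  congr 1
  rw [as_sum_range' g N (natDegree_lt_of_degree_lt_coe hN hg)]
  simp only [finsetSum_coeff, coeff_monomial, Finset.sum_ite_eq', Finset.mem_range,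
    C_mul_X_pow_eq_monomial]
  exact Finset.sum_congr rfl fun x hx => by rw [if_pos (Finset.mem_range.1 hx)]

/-- An element whose first `N - m` coordinates vanish is, up to a unit, represented by a polynomial
of degree less than `m`. -/
theorem exists_mk_eq_pow_mul (hN : N ≠ 0) (hy : y * Ideal.Quotient.mk _ X = 1)
    (hlam : IsUnit lam) {m : ℕ} (hm : m ≤ N) {z : ConstacyclicRing N lam}
    (hz : ∀ j, j < N - m → constTerm hN (y ^ j * z) = 0) :
    ∃ g : R[X], g.degree < m ∧ Ideal.Quotient.mk _ g = y ^ (N - m) * z := by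
  obtain ⟨g, hg, hgz⟩ := exists_mk_eq hN (y ^ (N - m) * z)
  refine ⟨g, (degree_lt_iff_coeff_zero _ _).2 fun j hj => ?_, hgz⟩
  rcases le_or_gt N j with h | h
  · exact (degree_lt_iff_coeff_zero _ _).1 hg j h
  · obtain ⟨l, hl⟩ := hlam.exists_left_inv
    rw [← constTerm_mul_mk hN hy hlam hg h, hgz]
    -- As `y^N = λ⁻¹`, coefficient `j ≥ m` is `λ⁻¹` times coordinate `j - m < N - m` of `z`.
    have : y ^ j * (y ^ (N - m) * z) = Ideal.Quotient.mk _ (C l) * (y ^ (j - m) * z) := by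
      rw [← inv_pow_card hy hl, ← mul_assoc, ← mul_assoc, ← pow_add, ← pow_add]
      congr 2
      omega
    rw [this, mk_C_mul_eq_smul, map_smul, hz _ (by omega), smul_zero]

end Coordinates

/-! ### Testing vanishing on each coprime factor. -/

section CoprimeFactors

variable {A ι : Type*} [CommRing A] [Fintype ι] [DecidableEq ι] {F : ι → A}

/-- The cofactors `∏_{l' ≠ l} F l' ^ M` generate the unit ideal; multiplying by one of them isolates
the component at `l`. -/
theorem eq_zero_of_forall_prod_erase_mul [Nonempty ι]
    (hF : Pairwise fun l l' => IsCoprime (F l) (F l')) (M : ℕ) {z : A}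
    (h : ∀ l, (∏ l' ∈ Finset.univ.erase l, F l' ^ M) * z = 0) : z = 0 := by
  obtain ⟨μ, hμ⟩ := (exists_sum_eq_one_iff_pairwise_coprime (s := fun l => F l ^ M)
    (Finset.univ_nonempty (α := ι))).2 fun a b hab => (hF (fun h => hab (Subtype.ext h))).pow
  calc z = (∑ l, μ l * ∏ l' ∈ Finset.univ \ {l}, F l' ^ M) * z := by rw [hμ, one_mul]
    _ = ∑ l, μ l * ((∏ l' ∈ Finset.univ.erase l, F l' ^ M) * z) := by
      rw [Finset.sum_mul]
      exact Finset.sum_congr rfl fun l _ => by rw [Finset.sdiff_singleton_eq_erase, mul_assoc]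
    _ = 0 := by simp [h]

theorem prod_erase_mul_eq_zero {E M : ℕ} (hE : (∏ l, F l) ^ E = 0) (hM : E ≤ M) {l : ι} {z : A}
    (hz : F l ^ E ∣ z) : (∏ l' ∈ Finset.univ.erase l, F l' ^ M) * z = 0 := by
  rw [← zero_dvd_iff, ← hE, ← Finset.prod_pow, ← Finset.prod_erase_mul _ _ (Finset.mem_univ l)]
  exact mul_dvd_mul (Finset.prod_dvd_prod_of_dvd _ _ fun a _ => pow_dvd_pow _ hM) hz

end CoprimeFactors

/-- In characteristic `p` modulo `γ`, the `q`-th power of `t = x ^ n - 1` is `γ` up to a unit. -/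
theorem exists_isUnit_mul_pow_eq {A : Type*} [CommRing A] {γ β t : A} {p : ℕ} (hp : p.Prime)
    (s : ℕ) (hγ : IsNilpotent γ) (hβ : IsUnit β) (hpγ : γ ∣ (p : A))
    (ht : (t + 1) ^ p ^ s = 1 + γ * β) : ∃ u : A, IsUnit u ∧ γ = u * t ^ p ^ s := by
  obtain ⟨r, hr⟩ := exists_add_pow_prime_pow_eq hp t 1 s
  obtain ⟨c, hc⟩ := hpγ
  have h1 : t ^ p ^ s = γ * (β - c * t * r) := by
    rw [hr, one_pow, hc] at ht
    linear_combination ht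
  -- Nilpotency of `t` makes `β - c t r` a unit plus a nilpotent.
  have hnil : IsNilpotent t := by
    have h2 : IsNilpotent (t ^ p ^ s) := h1 ▸ (Commute.all _ _).isNilpotent_mul_right hγ
    exact h2.of_pow
  have hu : IsUnit (β - c * t * r) := by
    have h3 : IsNilpotent (-(c * t * r)) := by
      rw [isNilpotent_neg_iff, show c * t * r = t * (c * r) by ring]
      exact (Commute.all _ _).isNilpotent_mul_right hnil
    rw [sub_eq_add_neg]
    exact h3.isUnit_add_left_of_commute hβ (Commute.all _ _)
  obtain ⟨v, hv⟩ := hu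
  refine ⟨(v⁻¹ : Aˣ), Units.isUnit _, ?_⟩
  rw [h1, ← hv, mul_comm γ, Units.inv_mul_cancel_left]

section Local

variable {R : Type*} [CommRing R] [IsLocalRing R] {γ : R}

theorem isNilpotent_of_maximalIdeal_eq_span [Finite R] (hγ : maximalIdeal R = Ideal.span {γ}) :
    IsNilpotent γ := by
  have h := IsArtinianRing.isNilpotent_jacobson_bot (R := R)
  rw [IsLocalRing.jacobson_eq_maximalIdeal ⊥ bot_ne_top] at h
  obtain ⟨j, hj⟩ := h
  refine ⟨j, ?_⟩
  have h' := Ideal.pow_mem_pow (hγ ▸ Ideal.mem_span_singleton_self γ : γ ∈ maximalIdeal R) j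
  rwa [hj] at h'

theorem dvd_natCast_of_charP (hγ : maximalIdeal R = Ideal.span {γ}) (p : ℕ)
    [CharP (ResidueField R) p] : γ ∣ (p : R) := by
  rw [← Ideal.mem_span_singleton, ← hγ, ← residue_eq_zero_iff, map_natCast, CharP.cast_eq_zero]

end Local

/-! ### Depth in terms of multiplication by powers of `x - 1`. -/

section ConstacyclicDepth

variable {R : Type*} [CommRing R] {N : ℕ} {lam : R} {y : ConstacyclicRing N lam}

theorem eq_zero_of_constTerm_eq_zero (hN : N ≠ 0) (hy : y * Ideal.Quotient.mk _ X = 1)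
    (hlam : IsUnit lam) {z : ConstacyclicRing N lam}
    (hz : ∀ j, j < N → constTerm hN (y ^ j * z) = 0) : z = 0 := by
  obtain ⟨g, hg, hgz⟩ := exists_mk_eq hN z
  rw [← hgz]
  convert map_zero (Ideal.Quotient.mk (Ideal.span {(X ^ N - C lam : R[X])}))
  ext j
  rcases lt_or_ge j N with h | h
  · rw [← constTerm_mul_mk hN hy hlam hg h, hgz, hz j h, coeff_zero]
  · exact (degree_lt_iff_coeff_zero _ _).1 hg j h

theorem inv_sub_one_pow_mul (hy : y * Ideal.Quotient.mk _ X = 1) (i : ℕ)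
    (z : ConstacyclicRing N lam) :
    (y - 1) ^ i * z = (-y) ^ i * ((Ideal.Quotient.mk _ X - 1) ^ i * z) := by
  rw [← mul_assoc, ← mul_pow]
  congr 2
  linear_combination hy

theorem depth_le_of_sub_one_pow_mul_eq_zero (hN : N ≠ 0) (hy : y * Ideal.Quotient.mk _ X = 1)
    (hlam : IsUnit lam) {c : Fin N → R} {i : ℕ} (hi : i < N)
    (h : (Ideal.Quotient.mk _ X - 1) ^ i * vecToRing N lam c = 0) : depth c ≤ i := by
  refine depth_le_of_iterVecDeriv hi (funext fun j => ?_)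
  rw [iterVecDeriv_apply hN hy hlam, inv_sub_one_pow_mul hy, h, mul_zero, mul_zero, map_zero]
  rfl

theorem depth_eq_of_sub_one_pow_mul (hN : N ≠ 0) (hy : y * Ideal.Quotient.mk _ X = 1)
    (hlam : IsUnit lam) {c : Fin N → R} {i : ℕ} (hi : i + 1 ≤ N)
    (h₁ : (Ideal.Quotient.mk _ X - 1) ^ i * vecToRing N lam c ≠ 0)
    (h₂ : (Ideal.Quotient.mk _ X - 1) ^ (i + 1) * vecToRing N lam c = 0) : depth c = i + 1 := by
  refine depth_eq_of_iterVecDeriv hi (fun h => h₁ ?_) fun _ => funext fun j => ?_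
  · have hyu : IsUnit y := IsUnit.of_mul_eq_one _ hy
    -- Since `(y - 1)^(i+1) c = 0`, all coordinates of `(y - 1)^i c` agree, so one zero entry of
    -- `D^i(c)` makes it vanish.
    have hfix : y * ((y - 1) ^ i * vecToRing N lam c) = (y - 1) ^ i * vecToRing N lam c := by
      have := inv_sub_one_pow_mul hy (i + 1) (vecToRing N lam c)
      rw [h₂, mul_zero] at this
      linear_combination this
    have hfix' : ∀ j, y ^ j * ((y - 1) ^ i * vecToRing N lam c) =
        (y - 1) ^ i * vecToRing N lam c := by
      intro j
      induction j with
      | zero => rw [pow_zero, one_mul]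
      | succ j ih => rw [pow_succ, mul_assoc, hfix, ih]
    have h0 : (y - 1) ^ i * vecToRing N lam c = 0 := by
      refine eq_zero_of_constTerm_eq_zero hN hy hlam fun j _ => ?_
      have h00 := congrFun h ⟨0, by omega⟩
      rw [iterVecDeriv_apply hN hy hlam, hfix'] at h00
      rw [hfix', h00]
      rfl
    rw [inv_sub_one_pow_mul hy] at h0
    exact (hyu.neg.pow i).mul_right_eq_zero.1 h0
  · rw [iterVecDeriv_apply hN hy hlam, inv_sub_one_pow_mul hy, h₂, mul_zero, mul_zero, map_zero]
    rfl

/-- Finite differences of binomial coefficients. -/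
theorem constTerm_sub_one_pow_mul_of_choose (hN : N ≠ 0) {L d : ℕ} {g : R}
    {b : ConstacyclicRing N lam}
    (hb : ∀ j, j < L → constTerm hN (y ^ j * b) = g * (j.choose d : R)) {i : ℕ} (hi : i ≤ d)
    {j : ℕ} (hj : j + i < L) :
    constTerm hN (y ^ j * ((y - 1) ^ i * b)) = g * (j.choose (d - i) : R) := by
  induction i generalizing j with
  | zero => simpa using hb j hj
  | succ i ih =>
    have h1 := ih (by omega) (j := j) (by omega)
    have h2 := ih (by omega) (j := j + 1) (by omega)
    rw [show y ^ j * ((y - 1) ^ (i + 1) * b) =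
      y ^ (j + 1) * ((y - 1) ^ i * b) - y ^ j * ((y - 1) ^ i * b) by ring, map_sub, h1, h2,
      show d - i = (d - (i + 1)) + 1 by omega, Nat.choose_succ_succ]
    push_cast
    ring

theorem depth_eq_of_choose (hN : N ≠ 0) (hy : y * Ideal.Quotient.mk _ X = 1) (hlam : IsUnit lam)
    {c : Fin N → R} {m d : ℕ} {g : R} (hg : g ≠ 0) (hd : m + d + 1 ≤ N)
    (hb : ∀ j, j < N - m → constTerm hN (y ^ j * ((y - 1) ^ m * vecToRing N lam c)) =
      g * (j.choose d : R)) : depth c = m + d + 1 := by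
  have key : ∀ j, j + d < N - m →
      constTerm hN (y ^ j * ((y - 1) ^ (m + d) * vecToRing N lam c)) = g := by
    intro j hj
    have h := constTerm_sub_one_pow_mul_of_choose hN hb le_rfl hj
    rw [Nat.sub_self, Nat.choose_zero_right, Nat.cast_one, mul_one] at h
    rw [← h]
    congr 1
    ring
  refine depth_eq_of_iterVecDeriv hd (fun h => hg ?_) fun _ => funext fun j => ?_
  · have h0 := congrFun h ⟨0, by omega⟩
    rw [iterVecDeriv_apply hN hy hlam, key _ (by dsimp only; omega)] at h0
    exact h0
  · have hj := j.2
    rw [iterVecDeriv_apply hN hy hlam, show y ^ (j : ℕ) * ((y - 1) ^ (m + d + 1) *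
      vecToRing N lam c) = y ^ ((j : ℕ) + 1) * ((y - 1) ^ (m + d) * vecToRing N lam c) -
        y ^ (j : ℕ) * ((y - 1) ^ (m + d) * vecToRing N lam c) by ring, map_sub,
      key _ (by omega), key _ (by omega), sub_self]
    rfl

/-- Place the values `w j` in degrees `deg G + j` and divide by `G`: subtracting the remainder
changes only coefficients below `deg G`. -/
theorem exists_mk_monic_mul_constTerm_eq (hN : N ≠ 0) (hy : y * Ideal.Quotient.mk _ X = 1)
    (hlam : IsUnit lam) {G : R[X]} (hG : G.Monic) (hGN : G.natDegree ≤ N) (w : ℕ → R) :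
    ∃ h : R[X], ∀ j, j < N - G.natDegree →
      constTerm hN (y ^ j * (y ^ G.natDegree * Ideal.Quotient.mk _ (G * h))) = w j := by
  nontriviality R
  set m := G.natDegree with hm
  set W : R[X] := ∑ j ∈ Finset.range (N - m), C (w j) * X ^ (m + j) with hW
  have hWc : ∀ j, j < N - m → W.coeff (m + j) = w j := by
    intro j hj
    simp [hW, hj, coeff_X_pow]
  have hmod := degree_modByMonic_lt W hG
  rw [degree_eq_natDegree hG.ne_zero, ← hm] at hmod
  have hWdeg : W.degree < (N : WithBot ℕ) := by
    refine (degree_sum_le _ _).trans_lt ((Finset.sup_lt_iff (WithBot.bot_lt_coe N)).2 ?_)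
    intro j hj
    rw [Finset.mem_range] at hj
    exact (degree_C_mul_X_pow_le _ _).trans_lt (WithBot.coe_lt_coe.2 (show m + j < N by omega))
  have hGW : G * (W /ₘ G) = W - W %ₘ G := by
    rw [eq_sub_iff_add_eq, add_comm, modByMonic_add_div]
  refine ⟨W /ₘ G, fun j hj => ?_⟩
  rw [← mul_assoc, ← pow_add, hGW, constTerm_mul_mk hN hy hlam ?_ (by omega), coeff_sub,
    add_comm j, hWc j hj, (degree_lt_iff_coeff_zero _ _).1 hmod _ (by omega), sub_zero]
  exact (degree_sub_le _ _).trans_lt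
    (max_lt hWdeg (hmod.trans_le (WithBot.coe_le_coe.2 hGN)))

/-- Up to a unit, `z` is a polynomial `g` of degree below `N - deg H`. Then `H g` has degree below
`N`, so its vanishing in the quotient already holds in `R[x]`. -/
theorem eq_zero_of_constTerm_eq_zero_of_mul_eq_zero (hN : N ≠ 0)
    (hy : y * Ideal.Quotient.mk _ X = 1) (hlam : IsUnit lam) {H : R[X]} (hH : H.Monic)
    (hHN : H.natDegree ≤ N) {z : ConstacyclicRing N lam}
    (hz : ∀ j, j < H.natDegree → constTerm hN (y ^ j * z) = 0)
    (hHz : Ideal.Quotient.mk _ H * z = 0) : z = 0 := by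
  nontriviality R
  obtain ⟨g, hg, hgz⟩ := exists_mk_eq_pow_mul (m := N - H.natDegree) hN hy hlam (by omega)
    (z := z) (fun j hj => hz j (by omega))
  have h0 : H * g = 0 := by
    refine mk_eq_zero_of_degree_lt hN (lam := lam) ?_ ?_
    · rw [mul_comm, hH.degree_mul, degree_eq_natDegree hH.ne_zero]
      rcases eq_or_ne g 0 with rfl | hg0
      · simp
      · rw [degree_eq_natDegree hg0] at hg ⊢
        have : g.natDegree < N - H.natDegree := WithBot.coe_lt_coe.1 hg
        exact WithBot.coe_lt_coe.2 (show g.natDegree + H.natDegree < N by omega)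
    · rw [map_mul, hgz, mul_left_comm, hHz, mul_zero]
  rw [hH.mul_right_eq_zero_iff.1 h0, map_zero] at hgz
  exact ((IsUnit.of_mul_eq_one _ hy).pow _).mul_right_eq_zero.1 hgz.symm

end ConstacyclicDepth

/-! ### Annihilators and divisibility, one factor at a time. -/

section FactorPowers

variable {A : Type*} [CommRing A] {r : ℕ} {F : Fin (r + 1) → A} {q e : ℕ} {k : Fin (r + 1) → ℕ}

/-- At `l = 0` the component of `z` vanishes. Elsewhere, if `k l > (e-1)q` the exponents add up to
`eq`; otherwise the exponent is `q` and `hz`, which encodes `γz = 0`, applies. -/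
theorem prod_pow_tau_mul_eq_zero (hF : Pairwise fun l l' => IsCoprime (F l) (F l'))
    (he : 1 ≤ e) (hE : (∏ l, F l) ^ (e * q) = 0) {z : A} (h0 : F 0 ^ (e * q) ∣ z)
    (hk : ∀ l, F l ^ k l ∣ z) (hz : (∏ l, F l) ^ q * z = 0) (hkE : ∀ l, k l ≤ e * q) :
    (∏ l : Fin r, F l.succ ^ (q - (k l.succ - (e - 1) * q))) * z = 0 := by
  obtain ⟨e, rfl⟩ := Nat.exists_eq_add_of_le' he
  refine eq_zero_of_forall_prod_erase_mul hF ((e + 1) * q) fun l => ?_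
  have hdvd : ∀ l : Fin r, F l.succ ^ (q - (k l.succ - e * q)) ∣
      ∏ l : Fin r, F l.succ ^ (q - (k l.succ - e * q)) := fun l =>
    Finset.dvd_prod_of_mem (fun l : Fin r => F l.succ ^ (q - (k l.succ - e * q)))
      (Finset.mem_univ l)
  rw [Nat.add_sub_cancel]
  cases l using Fin.cases with
  | zero => exact prod_erase_mul_eq_zero hE le_rfl (dvd_mul_of_dvd_right h0 _)
  | succ l =>
    have hkl := hkE l.succ
    rw [add_mul, one_mul] at hkl
    rcases lt_or_ge (e * q) (k l.succ) with h | h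
    · refine prod_erase_mul_eq_zero hE le_rfl ?_
      have := mul_dvd_mul (hdvd l) (hk l.succ)
      rwa [← pow_add, show q - (k l.succ - e * q) + k l.succ = (e + 1) * q by
        rw [add_mul, one_mul]; omega] at this
    · rw [← zero_dvd_iff, ← hz, ← Finset.prod_pow,
        ← Finset.prod_erase_mul _ _ (Finset.mem_univ l.succ), mul_assoc]
      refine mul_dvd_mul (Finset.prod_dvd_prod_of_dvd _ _ fun a _ => pow_dvd_pow _ ?_)
        (mul_dvd_mul_right ?_ _)
      · exact Nat.le_mul_of_pos_left q (Nat.succ_pos e)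
      · have := hdvd l
        rwa [show q - (k l.succ - e * q) = q by omega] at this

/-- Away from the factor `0`, `F 0` is invertible, so `hM` kills those components; at the factor
`0`, the total exponent reaches `eq`. -/
theorem pow_sub_mul_eq_zero (hF : Pairwise fun l l' => IsCoprime (F l) (F l'))
    (hE : (∏ l, F l) ^ (e * q) = 0) {z : A} (hz : F 0 ^ k 0 ∣ z) (hk : k 0 ≤ e * q) {M : ℕ}
    (hM : F 0 ^ M * z = 0) : F 0 ^ (e * q - k 0) * z = 0 := by
  refine eq_zero_of_forall_prod_erase_mul hF (max (e * q) M) fun l => ?_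
  cases l using Fin.cases with
  | zero =>
    refine prod_erase_mul_eq_zero hE (le_max_left _ _) ?_
    have := mul_dvd_mul_left (F 0 ^ (e * q - k 0)) hz
    rwa [← pow_add, Nat.sub_add_cancel hk] at this
  | succ l =>
    rw [← zero_dvd_iff, ← hM]
    refine mul_dvd_mul ?_ (dvd_mul_left _ _)
    exact (pow_dvd_pow _ (le_max_right _ _)).trans
      (Finset.dvd_prod_of_mem (fun l => F l ^ max (e * q) M)
        (Finset.mem_erase.2 ⟨(Fin.succ_ne_zero l).symm, Finset.mem_univ _⟩))

/-- The right side is `F 0 ^ (eq) * B`. It vanishes at the factor `0`, and on the others `F 0` is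
invertible, so it can be divided by `F 0 ^ (m + k 0)`; the Bézout coefficient `α` does this. -/
theorem exists_pow_mul_eq (hF : Pairwise fun l l' => IsCoprime (F l) (F l'))
    (he : 1 ≤ e) (hE : (∏ l, F l) ^ (e * q) = 0) (m : ℕ) :
    ∃ a, F 0 ^ k 0 * ∏ l : Fin r, F l.succ ^ k l.succ ∣ a ∧
      F 0 ^ m * a = (∏ l, F l) ^ (q * (e - 1)) *
        (F 0 ^ q * ∏ l : Fin r, F l.succ ^ (k l.succ - (e - 1) * q)) := by
  obtain ⟨e, rfl⟩ := Nat.exists_eq_add_of_le' he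
  rw [Nat.add_sub_cancel]
  set B := ∏ l : Fin r, F l.succ ^ (e * q + (k l.succ - e * q)) with hB
  have hcop : IsCoprime (F 0 ^ (m + k 0)) (∏ l : Fin r, F l.succ ^ ((e + 1) * q)) :=
    IsCoprime.prod_right fun l _ => (hF (Fin.succ_ne_zero l).symm).pow
  obtain ⟨α, δ, hαδ⟩ := hcop
  have hz : F 0 ^ ((e + 1) * q) * ∏ l : Fin r, F l.succ ^ ((e + 1) * q) = 0 := by
    rw [← hE, ← Finset.prod_pow, Fin.prod_univ_succ]
  refine ⟨F 0 ^ k 0 * (α * F 0 ^ ((e + 1) * q) * B), ?_, ?_⟩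
  · refine mul_dvd_mul_left _ (dvd_mul_of_dvd_right ?_ _)
    exact Finset.prod_dvd_prod_of_dvd _ _ fun l _ => pow_dvd_pow _ (by omega)
  · have hrhs : (∏ l, F l) ^ (q * e) * (F 0 ^ q * ∏ l : Fin r, F l.succ ^ (k l.succ - e * q)) =
        F 0 ^ ((e + 1) * q) * B := by
      rw [← Finset.prod_pow, Fin.prod_univ_succ, hB]
      simp only [pow_add, Finset.prod_mul_distrib, add_mul, one_mul, mul_comm q e]
      ring
    rw [hrhs]
    linear_combination F 0 ^ ((e + 1) * q) * B * hαδ - B * δ * hz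

end FactorPowers

/-! ### The depth spectrum, without case distinction. -/

theorem depthSpectrum_eq {R : Type*} [CommRing R] {γ : R} {e : ℕ} (he : 1 ≤ e)
    (hγ : γ ^ (e - 1) ≠ 0) (hγe : γ ^ e = 0)
    {N n q : ℕ} {lam : R} (hNq : N = n * q) (hq : 1 ≤ q) (hn : 1 ≤ n) (hlam : IsUnit lam)
    {r : ℕ} {f : Fin (r + 1) → R[X]}
    (hmonic : ∀ l, (f l).Monic) (hcop : ∀ l l', l ≠ l' → IsCoprime (f l) (f l'))
    (hprod : ∏ l, f l = X ^ n - 1) (hf₁ : f 0 = X - 1)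
    (k : Fin (r + 1) → ℕ) (hk : ∀ l, k l ≤ e * q)
    (hγq : ∃ u : ConstacyclicRing N lam, IsUnit u ∧
      Ideal.Quotient.mk _ (C γ) = u * (Ideal.Quotient.mk _ (X ^ n - 1)) ^ q)
    (I : Ideal (ConstacyclicRing N lam))
    (hI : I = Ideal.span {Ideal.Quotient.mk _
      ((X - 1) ^ k 0 * ∏ l : Fin r, f l.succ ^ k l.succ)})
    (S₂ : ℕ)
    (hS₂ : S₂ = ∑ l : Fin r, (f l.succ).natDegree * (k l.succ - (e - 1) * q)) :
    depthSpectrum (codeOfIdeal I) = (Set.Icc 1 (e * q - k 0) ∪ Set.Icc (q + S₂ + 1) N) ∩ Set.Iic N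
    := by
  have : Nontrivial R := nontrivial_of_ne _ _ hγ
  have hN : N ≠ 0 := by rw [hNq]; positivity
  obtain ⟨u, hu, hΓ⟩ := hγq
  set F : Fin (r + 1) → ConstacyclicRing N lam := fun l => Ideal.Quotient.mk _ (f l) with hFdef
  have hF : Pairwise fun l l' => IsCoprime (F l) (F l') := fun l l' h => (hcop l l' h).map _
  have hFprod : ∏ l, F l = Ideal.Quotient.mk _ (X ^ n - 1) := by rw [← hprod, map_prod]
  have hF0 : F 0 = Ideal.Quotient.mk _ X - 1 := by
    simp only [hFdef, hf₁, map_sub, map_one]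
  rw [← hFprod] at hΓ
  have hE : (∏ l, F l) ^ (e * q) = 0 := by
    have h : (Ideal.Quotient.mk (Ideal.span {(X ^ N - C lam : R[X])}) (C γ)) ^ e = 0 := by
      rw [← map_pow, ← C_pow, hγe, C_0, map_zero]
    rw [hΓ, mul_pow, ← pow_mul, mul_comm q] at h
    exact (hu.pow e).mul_right_eq_zero.1 h
  obtain ⟨l, hl⟩ := hlam.exists_left_inv
  obtain ⟨y, hy⟩ : ∃ y : ConstacyclicRing N lam, y * Ideal.Quotient.mk _ X = 1 := by
    refine ⟨Ideal.Quotient.mk _ (C l) * Ideal.Quotient.mk _ X ^ (N - 1), ?_⟩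
    rw [mul_assoc, pow_sub_one_mul hN, mk_X_pow_card, ← map_mul, ← C_mul, hl, C_1, map_one]
  have hyu : IsUnit y := IsUnit.of_mul_eq_one _ hy
  have hgen : I = Ideal.span {F 0 ^ k 0 * ∏ l : Fin r, F l.succ ^ k l.succ} := by
    simp only [hI, hFdef, hf₁, map_mul, map_pow, map_prod]
  have hdeg : 1 + ∑ l : Fin r, (f l.succ).natDegree = n := by
    have h := natDegree_prod_of_monic Finset.univ f fun l _ => hmonic l
    rw [hprod, ← C_1, natDegree_X_pow_sub_C, Fin.sum_univ_succ, hf₁, ← C_1,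
      natDegree_X_sub_C] at h
    exact h.symm
  set t : Fin r → ℕ := fun l => k l.succ - (e - 1) * q with ht
  have htq : ∀ l, t l ≤ q := by
    intro l
    have := hk l.succ
    obtain ⟨e, rfl⟩ := Nat.exists_eq_add_of_le' he
    simp only [ht, Nat.add_sub_cancel]
    rw [add_mul] at this
    omega
  -- `H` and the `G` below multiply to `(x^n - 1)^q`, so their degrees add up to `N`.
  set H : R[X] := ∏ l : Fin r, f l.succ ^ (q - t l) with hHdef
  have hH : H.Monic := monic_prod_of_monic _ _ fun l _ => (hmonic _).pow _
  have hHdeg : H.natDegree + (q + S₂) = N := by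
    rw [hHdef, natDegree_prod_of_monic _ _ fun l _ => (hmonic _).pow _, hS₂, add_left_comm,
      ← Finset.sum_add_distrib, hNq, ← hdeg, add_mul, one_mul, Finset.sum_mul]
    congr 1
    refine Finset.sum_congr rfl fun l _ => ?_
    rw [(hmonic _).natDegree_pow, mul_comm (q - t l), ← mul_add, Nat.sub_add_cancel (htq l)]
  set G : R[X] := f 0 ^ q * ∏ l : Fin r, f l.succ ^ t l with hGdef
  have hG1 : (∏ l : Fin r, f l.succ ^ t l).Monic :=
    monic_prod_of_monic _ _ fun l _ => (hmonic _).pow _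
  have hG : G.Monic := ((hmonic 0).pow q).mul hG1
  have hGdeg : G.natDegree = q + S₂ := by
    rw [hGdef, ((hmonic 0).pow q).natDegree_mul hG1, (hmonic 0).natDegree_pow, hf₁, ← C_1,
      natDegree_X_sub_C, mul_one, natDegree_prod_of_monic _ _ fun l _ => (hmonic _).pow _, hS₂]
    congr 1
    exact Finset.sum_congr rfl fun l _ => by rw [(hmonic _).natDegree_pow, mul_comm]
  have hmem : ∀ z, z ∈ I ↔ F 0 ^ k 0 * ∏ l : Fin r, F l.succ ^ k l.succ ∣ z := fun z => by
    rw [hgen, Ideal.mem_span_singleton]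
  have hmemk : ∀ z ∈ I, ∀ l, F l ^ k l ∣ z := by
    intro z hz l
    rw [hmem, ← Fin.prod_univ_succ (fun l => F l ^ k l)] at hz
    exact (Finset.dvd_prod_of_mem (fun l => F l ^ k l) (Finset.mem_univ l)).trans hz
  have hΓpow : Ideal.Quotient.mk (Ideal.span {(X ^ N - C lam : R[X])}) (C (γ ^ (e - 1))) =
      u ^ (e - 1) * (∏ l, F l) ^ (q * (e - 1)) := by
    rw [C_pow, map_pow, hΓ, mul_pow, ← pow_mul]
  have hnonzero : F 0 ^ (e * q - 1) * ∏ l : Fin r, F l.succ ^ (e * q) ≠ 0 := by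
    intro h
    -- Up to a unit the element is `γ^(e-1) P`, with `P` monic of degree `N - 1`, so no reduction
    -- modulo `x^N - λ` takes place.
    set P : R[X] := f 0 ^ (q - 1) * ∏ l : Fin r, f l.succ ^ q with hPdef
    have hP1 : (∏ l : Fin r, f l.succ ^ q).Monic :=
      monic_prod_of_monic _ _ fun l _ => (hmonic _).pow _
    have hP : P.Monic := ((hmonic 0).pow _).mul hP1
    have hPdeg : P.natDegree + 1 = N := by
      rw [hPdef, ((hmonic 0).pow _).natDegree_mul hP1, (hmonic 0).natDegree_pow, hf₁, ← C_1,
        natDegree_X_sub_C, mul_one, natDegree_prod_of_monic _ _ fun l _ => (hmonic _).pow _,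
        hNq, ← hdeg, add_mul, one_mul, Finset.sum_mul]
      simp only [(hmonic _).natDegree_pow, mul_comm q]
      omega
    have h0 : C (γ ^ (e - 1)) * P = 0 := by
      refine mk_eq_zero_of_degree_lt hN (lam := lam) ?_ ?_
      · refine (degree_mul_le_of_le degree_C_le degree_le_natDegree).trans_lt ?_
        rw [zero_add]
        exact WithBot.coe_lt_coe.2 (show P.natDegree < N by omega)
      · have hPF : Ideal.Quotient.mk (Ideal.span {(X ^ N - C lam : R[X])}) P =
            F 0 ^ (q - 1) * ∏ l : Fin r, F l.succ ^ q := by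
          simp only [hPdef, hFdef, map_mul, map_pow, map_prod]
        have hexp : q * (e - 1) + q = e * q := by
          obtain ⟨e, rfl⟩ := Nat.exists_eq_add_of_le' he
          rw [Nat.add_sub_cancel]; ring
        rw [map_mul, hΓpow, hPF, mul_assoc, ← Finset.prod_pow, Fin.prod_univ_succ, mul_mul_mul_comm,
          ← pow_add, ← Finset.prod_mul_distrib]
        simp only [← pow_add, hexp]
        rw [show q * (e - 1) + (q - 1) = e * q - 1 by omega, h, mul_zero]
    have h1 := congrArg (fun g => g.coeff P.natDegree) h0
    simp only [coeff_C_mul, hP.coeff_natDegree, mul_one, coeff_zero] at h1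
    exact hγ h1
  -- a codeword killed by `D^(q + S₂)` is killed by a power of `x - 1`
  have hkill : e * q ≤ q + S₂ + k 0 → ∀ z ∈ I,
      (∀ j, j < H.natDegree → constTerm hN (y ^ j * ((y - 1) ^ (q + S₂) * z)) = 0) →
      F 0 ^ (q + S₂) * z = 0 := by
    intro hle z hz hj
    -- All hypotheses on `w` pass to `γ • w`, so the induction reduces to `γ • w = 0`.
    have key : ∀ (i : ℕ) (w : ConstacyclicRing N lam), F 0 ^ (e * q) ∣ w → (∀ l, F l ^ k l ∣ w) →
        (∀ j, j < H.natDegree → constTerm hN (y ^ j * w) = 0) → (γ ^ i) • w = 0 → w = 0 := by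
      intro i
      induction i with
      | zero => intro w _ _ _ h; rwa [pow_zero, one_smul] at h
      | succ i ih =>
        intro w hw0 hwk hwj hwi
        have hγw : γ • w = 0 := by
          refine ih (γ • w) ?_ (fun l => ?_) (fun j hj => ?_) (by rw [smul_smul, ← pow_succ, hwi])
          · rw [← mk_C_mul_eq_smul]; exact dvd_mul_of_dvd_right hw0 _
          · rw [← mk_C_mul_eq_smul]; exact dvd_mul_of_dvd_right (hwk l) _
          · rw [mul_smul_comm, map_smul, hwj j hj, smul_zero]
        refine eq_zero_of_constTerm_eq_zero_of_mul_eq_zero hN hy hlam hH (by omega) hwj ?_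
        rw [← mk_C_mul_eq_smul, hΓ, mul_assoc] at hγw
        have := prod_pow_tau_mul_eq_zero hF he hE hw0 hwk (hu.mul_right_eq_zero.1 hγw) hk
        simpa only [hHdef, hFdef, map_pow, map_prod] using this
    have h0 : (y - 1) ^ (q + S₂) * z = 0 := by
      refine key e _ ?_ (fun l => dvd_mul_of_dvd_right (hmemk z hz l) _) hj
        (by rw [hγe, zero_smul])
      rw [inv_sub_one_pow_mul hy, ← hF0]
      refine dvd_mul_of_dvd_right ((pow_dvd_pow _ hle).trans ?_) _
      rw [pow_add]
      exact mul_dvd_mul_left _ (hmemk z hz 0)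
    rw [inv_sub_one_pow_mul hy, ← hF0] at h0
    exact (hyu.neg.pow _).mul_right_eq_zero.1 h0
  ext i
  constructor
  · rintro ⟨hi1, hiN, c, hc, rfl⟩
    refine ⟨?_, hiN⟩
    by_contra hcon
    simp only [Set.mem_union, Set.mem_Icc, not_or, not_and, not_le] at hcon
    obtain ⟨hcon1, hcon2⟩ := hcon
    have hlt := hcon1 hi1
    have hdm : depth c ≤ q + S₂ := by
      by_contra hlt'
      have := hcon2 (by omega)
      omega
    have hD := iterVecDeriv_eq_zero_of_depth_le hdm
    have h0 := hkill (by omega) _ hc fun j hj => by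
      have := congrFun hD ⟨j, by omega⟩
      rwa [iterVecDeriv_apply hN hy hlam] at this
    have h1 := pow_sub_mul_eq_zero hF hE (hmemk _ hc 0) (hk 0) h0
    rw [hF0] at h1
    have := depth_le_of_sub_one_pow_mul_eq_zero hN hy hlam (by omega) h1
    omega
  · rintro ⟨hi | hi, hiN⟩
    · obtain ⟨i, rfl⟩ := Nat.exists_eq_add_of_le' hi.1
      have hi2 := hi.2
      obtain ⟨c, hc⟩ := vecToRing_surjective (lam := lam) hN
        (F 0 ^ (e * q - (i + 1)) * ∏ l : Fin r, F l.succ ^ (e * q))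
      refine ⟨hi.1, hiN, c, ?_, depth_eq_of_sub_one_pow_mul hN hy hlam hiN ?_ ?_⟩
      · change vecToRing N lam c ∈ I
        rw [hc, hmem]
        exact mul_dvd_mul (pow_dvd_pow _ (by omega))
          (Finset.prod_dvd_prod_of_dvd _ _ fun l _ => pow_dvd_pow _ (hk _))
      · rw [hc, ← hF0, ← mul_assoc, ← pow_add, show i + (e * q - (i + 1)) = e * q - 1 by omega]
        exact hnonzero
      · rw [hc, ← hF0, ← mul_assoc, ← pow_add, show i + 1 + (e * q - (i + 1)) = e * q by omega,
          ← Fin.prod_univ_succ (fun l => F l ^ (e * q)), Finset.prod_pow, hE]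
    · obtain ⟨d, rfl⟩ := Nat.exists_eq_add_of_le hi.1
      rw [show q + S₂ + 1 + d = q + S₂ + d + 1 by ring] at hiN ⊢
      obtain ⟨h, hh⟩ := exists_mk_monic_mul_constTerm_eq hN hy hlam hG (by omega)
        (fun j => (j.choose d : R))
      rw [hGdeg] at hh
      obtain ⟨a, haI, ha⟩ := exists_pow_mul_eq (k := k) hF he hE (q + S₂)
      -- The sign cancels that of `y - 1 = -y(x - 1)`; `u^(e-1)` turns `(∏ F l)^(q(e-1))` into
      -- `γ^(e-1)`.
      obtain ⟨c, hc⟩ := vecToRing_surjective (lam := lam) hN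
        ((-1) ^ (q + S₂) * (u ^ (e - 1) * a * Ideal.Quotient.mk _ h))
      refine ⟨by omega, hiN, c, ?_, depth_eq_of_choose hN hy hlam hγ hiN fun j hj => ?_⟩
      · change vecToRing N lam c ∈ I
        rw [hc, hmem]
        exact dvd_mul_of_dvd_right (dvd_mul_of_dvd_left (dvd_mul_of_dvd_right haI _) _) _
      · rw [← hh j hj, ← smul_eq_mul (γ ^ (e - 1)), ← map_smul (constTerm hN), ← mk_C_mul_eq_smul, hΓpow, hc,
          inv_sub_one_pow_mul hy, ← hF0]
        congr 1
        have hGF : Ideal.Quotient.mk (Ideal.span {(X ^ N - C lam : R[X])}) G =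
            F 0 ^ q * ∏ l : Fin r, F l.succ ^ t l := by
          simp only [hGdef, hFdef, map_mul, map_pow, map_prod]
        have h1 : ((-1) ^ (q + S₂) : ConstacyclicRing N lam) * (-1) ^ (q + S₂) = 1 := by
          rw [← mul_pow]; norm_num
        rw [map_mul, hGF, neg_pow y]
        linear_combination (y ^ j * y ^ (q + S₂) * F 0 ^ (q + S₂) * u ^ (e - 1) * a *
          Ideal.Quotient.mk _ h) * h1 +
          (y ^ j * y ^ (q + S₂) * u ^ (e - 1) * Ideal.Quotient.mk _ h) * ha

theorem theorem3p3 {R : Type*} [CommRing R] [Finite R] [IsChainRing R]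
    (γ : R) (hγ : maximalIdeal R = Ideal.span {γ})
    (e : ℕ) (he : e = nilpotencyClass γ)
    (p : ℕ) (hp : p.Prime) (hchar : CharP (ResidueField R) p)
    (n s : ℕ) (hn : Nat.gcd n p = 1)
    (β lam : R) (hβ : IsUnit β) (hlam : lam = 1 + γ * β)
    (r : ℕ) (f : Fin (r + 1) → R[X])
    (hf : IsBasicFactorization (X ^ n - 1) f) (hf₁ : f 0 = X - 1)
    (k : Fin (r + 1) → ℕ) (hk : ∀ l, k l ≤ e * p ^ s)
    (I : Ideal (ConstacyclicRing (n * p ^ s) lam))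
    (hI : I = Ideal.span {Ideal.Quotient.mk _
      ((X - 1) ^ k 0 * ∏ l : Fin r, f l.succ ^ k l.succ)})
    (S₂ : ℕ)
    (hS₂ : S₂ = ∑ l : Fin r, (f l.succ).natDegree * tau (p ^ s) (k l.succ) (e - 1)) :
    ((k 0 : ℤ) < max 0 (((e : ℤ) - (n : ℤ)) * (p : ℤ) ^ s) →
      depthSpectrum (codeOfIdeal I) = Set.Icc 1 (n * p ^ s)) ∧
    (¬ (k 0 : ℤ) < max 0 (((e : ℤ) - (n : ℤ)) * (p : ℤ) ^ s) →
      depthSpectrum (codeOfIdeal I) =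
        Set.Icc 1 (e * p ^ s - k 0) ∪ Set.Icc (p ^ s + S₂ + 1) (n * p ^ s)) := by
  have hnil := isNilpotent_of_maximalIdeal_eq_span hγ
  have he1 : 1 ≤ e := by
    rw [he]
    exact Nat.one_le_iff_ne_zero.2 (pos_nilpotencyClass_iff.2 hnil).ne'
  have hγe : γ ^ e = 0 := he ▸ pow_nilpotencyClass hnil
  have hγe' : γ ^ (e - 1) ≠ 0 := he ▸ pow_pred_nilpotencyClass hnil
  have hn1 : 1 ≤ n := by
    rcases Nat.eq_zero_or_pos n with rfl | h
    · rw [Nat.gcd_zero_left] at hn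
      exact absurd hn hp.one_lt.ne'
    · exact h
  have hlamu : IsUnit lam := by
    rw [hlam]
    exact ((Commute.all _ _).isNilpotent_mul_right hnil).isUnit_one_add
  have hq : 1 ≤ p ^ s := Nat.one_le_pow _ _ hp.pos
  have htau : ∀ l, tau (p ^ s) (k l) (e - 1) = k l - (e - 1) * p ^ s := by
    intro l
    have := hk l
    rw [tau, Nat.sub_add_cancel he1]
    omega
  have hγq : ∃ u : ConstacyclicRing (n * p ^ s) lam, IsUnit u ∧
      Ideal.Quotient.mk _ (C γ) = u * (Ideal.Quotient.mk _ (X ^ n - 1)) ^ p ^ s := by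
    refine exists_isUnit_mul_pow_eq hp s (hnil.map C |>.map _)
      ((hβ.map C).map (Ideal.Quotient.mk _)) ?_ ?_
    · have h := map_dvd (Ideal.Quotient.mk (Ideal.span {(X ^ (n * p ^ s) - C lam : R[X])}))
        (map_dvd C (dvd_natCast_of_charP hγ p))
      rwa [map_natCast, map_natCast] at h
    · rw [map_sub, map_one, sub_add_cancel, map_pow, ← pow_mul, mk_X_pow_card, ← map_mul, ← C_mul, ← map_one
        (Ideal.Quotient.mk _), ← map_add, ← C_1, ← C_add, ← hlam]
  have hmain := depthSpectrum_eq he1 hγe' hγe rfl hq hn1 hlamu hf.monic hf.coprime hf.prod_eq hf₁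
    k hk hγq I hI S₂ (by simp only [hS₂, htau])
  rw [hmain]
  constructor
  · intro h
    -- In this case the first interval already covers `1, …, N`; in the other it ends by `N`, so
    -- intersecting with `Set.Iic` changes nothing.
    have h' : n * p ^ s ≤ e * p ^ s - k 0 := by
      have h2 : (k 0 : ℤ) < ((e : ℤ) - (n : ℤ)) * (p : ℤ) ^ s := by
        rcases lt_max_iff.1 h with h | h
        · omega
        · exact h
      have h3 : k 0 + n * p ^ s < e * p ^ s := by
        zify
        linarith
      omega
    ext i
    simp only [Set.mem_inter_iff, Set.mem_union, Set.mem_Icc, Set.mem_Iic]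
    omega
  · intro h
    have h' : e * p ^ s - k 0 ≤ n * p ^ s := by
      have h2 := (le_max_right _ _).trans (not_lt.1 h)
      have h3 : e * p ^ s ≤ n * p ^ s + k 0 := by
        zify
        linarith
      omega
    ext i
    simp only [Set.mem_inter_iff, Set.mem_union, Set.mem_Icc, Set.mem_Iic]
    omega
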